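/- **Proposition 4.** Let $D\subset\mathbb{R}^2$ be a compact set whose topological boundary is the union of the traces of finitely many closed piecewise $C^1$ curves $\gamma_1,\dots,\gamma_N$ that form its positively oriented boundary, i.e. their total winding number is $1$ around every interior point of $D$ and $0$ around every point outside $D$. Let $\boldsymbol\Sigma$ be a $C^3$ map from an open neighbourhood of $D$ to $\mathbb{R}^3$ that is regular on $D$: $\mathbf{g}_i=\partial\boldsymbol\Sigma/\partial x^i$ ($i=1,2$) are linearly independent there. On the parametrized surface $\Sigma=\boldsymbol\Sigma(D)$ put $\mathbf{n}=\frac{\mathbf{g}_1\times\mathbf{g}_2}{|\mathbf{g}_1\times\mathbf{g}_2|}$, $g_{ij}=(\mathbf{g}_i,\mathbf{g}_j)$, $[g^{ij}]=[g_{ij}]^{-1}$, $\mathbf{g}^i=g^{ij}\mathbf{g}_j$, $b_{ij}=\left(\frac{\partial\mathbf{g}_i}{\partial x^j},\mathbf{n}\right)$, $b^i_j=g^{ik}b_{kj}$, $K_G=\det[b_{ij}]/\det[g_{ij}]$, let $\mathbf{K}=b^i_j\,\mathbf{g}_i\otimes\mathbf{g}^j$ be the curvature tensor, and assume that $|\mathbf{K}|:=\det[b^i_j]\neq0$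 on $D$. Let $\hat{\mathbf{L}}=|\mathbf{K}|\,\mathbf{K}^{-1}=\hat L^i_j\,\mathbf{g}_i\otimes\mathbf{g}^j$, where $[\hat L^i_j]=\det[b^i_j]\,[b^i_j]^{-1}$, let $\hat L^{ij}=\hat L^i_k g^{kj}$, and let $\overset{\Sigma}{\overline{\boldsymbol\nabla}}=\hat L^{ij}\mathbf{g}_i\frac{\partial}{\partial x^j}$. Let $\boldsymbol\Phi$ be a $C^1$ field (on a neighbourhood of $D$) of tensors of order $p$ over $\mathbb{R}^3$, and let $\circ$ be any bilinear algebraic operation that sends a vector of $\mathbb{R}^3$ and a tensor of order $p$ to a tensor of order $q$ (tensor product, contraction, cross product, …). Write $\overset{\Sigma}{\overline{\boldsymbol\nabla}}\circ\boldsymbol\Phi=\hat L^{ij}\,\mathbf{g}_i\circ\frac{\partial\boldsymbol\Phi}{\partial x^j}$. Then $$\oint_{\partial\Sigma}\big((\boldsymbol\tau\times\mathbf{n})\cdot\hat{\mathbf{L}}\big)\circ\boldsymbol\Phi\,dl=\int_\Sigma\overset{\Sigma}{\overline{\boldsymbol\nabla}}\circ\boldsymbol\Phi\,d\sigma+\int_\Sigma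 2K_G\,(\mathbf{n}\circ\boldsymbol\Phi)\,d\sigma ,$$ where $\partial\Sigma$ consists of the curves $\boldsymbol\Sigma\circ\gamma_k$, $\boldsymbol\tau$ is their unit tangent vector, $dl$ their arc length element, and $d\sigma=\sqrt{\det[g_{ij}]}\,dx^1dx^2$. -/

import Mathlib

noncomputable section

/-- The parameter plane `ℝ²`. -/
abbrev E2 : Type := EuclideanSpace ℝ (Fin 2)

/-- The ambient Euclidean space `ℝ³`. -/
abbrev E3 : Type := EuclideanSpace ℝ (Fin 3)

/-- Tensors of order `p` over `ℝ³`, as `p`-linear forms (`ℝ³` is identified with its dual by the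
Euclidean inner product, so co- and contravariant slots are not distinguished). -/
abbrev Tensor (p : ℕ) : Type := ContinuousMultilinearMap ℝ (fun _ : Fin p => E3) ℝ

/-- The cross product of `ℝ³`. -/
def cross (a b : E3) : E3 :=
  WithLp.toLp 2 (crossProduct (WithLp.ofLp a) (WithLp.ofLp b))

/-! ### Plane domains and their oriented boundaries -/

/-- A closed, piecewise continuously differentiable curve in the plane, parametrized by `[0, 1]`:
it is continuous, and `C¹` (with one-sided derivatives at the ends) on each closed interval whose
interior contains none of finitely many break points. -/
structure ClosedCurve where
  /-- the parametrization; only its values on `[0, 1]` matter -/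
  toFun : ℝ → E2
  /-- the break points, where the curve may have corners -/
  breaks : Finset ℝ
  continuousOn : ContinuousOn toFun (Set.Icc 0 1)
  closed : toFun 0 = toFun 1
  contDiffOn : ∀ a b : ℝ, 0 ≤ a → a < b → b ≤ 1 → (∀ c ∈ breaks, c ∉ Set.Ioo a b) →
    ContDiffOn ℝ 1 toFun (Set.Icc a b)

/-- The trace of a closed curve. -/
def ClosedCurve.trace (γ : ClosedCurve) : Set E2 := γ.toFun '' Set.Icc 0 1

/-- The winding number of a closed curve around a point `z` off its trace,
`(2π)⁻¹ ∮ ((x - z₁) dy - (y - z₂) dx) / |(x, y) - z|²`. -/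
def ClosedCurve.winding (γ : ClosedCurve) (z : E2) : ℝ :=
  (2 * Real.pi)⁻¹ * ∫ t in (0 : ℝ)..1,
    ((γ.toFun t - z) 0 * (deriv γ.toFun t) 1 - (γ.toFun t - z) 1 * (deriv γ.toFun t) 0)
      / ‖γ.toFun t - z‖ ^ 2

/-- Finitely many closed curves form the positively oriented boundary of the plane set `D`: their
traces make up the topological boundary of `D`, and together they wind once counterclockwise around
each interior point of `D` and zero times around each exterior point. -/
structure IsOrientedBoundary {N : ℕ} (γ : Fin N → ClosedCurve) (D : Set E2) : Prop where
  frontier_eq : frontier D = ⋃ k, (γ k).trace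
  winding_interior : ∀ z ∈ interior D, ∑ k, (γ k).winding z = 1
  winding_exterior : ∀ z, z ∉ closure D → ∑ k, (γ k).winding z = 0

/-! ### A parametrized surface `S : ℝ² ⊇ D → ℝ³` -/

/-- The partial derivative `∂f/∂xⁱ` of a function of the surface coordinates. -/
def pderiv {F : Type*} [NormedAddCommGroup F] [NormedSpace ℝ F]
    (f : E2 → F) (i : Fin 2) (x : E2) : F :=
  fderiv ℝ f x (EuclideanSpace.single i 1)

/-- The covariant basis `g_i = ∂S/∂xⁱ`. -/
def covBasis (S : E2 → E3) (i : Fin 2) (x : E2) : E3 := pderiv S i x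

/-- The unit normal `n = (g_1 × g_2) / |g_1 × g_2|`. -/
def unitNormal (S : E2 → E3) (x : E2) : E3 :=
  ‖cross (covBasis S 0 x) (covBasis S 1 x)‖⁻¹ • cross (covBasis S 0 x) (covBasis S 1 x)

/-- The metric matrix `g_ij = (g_i, g_j)`. -/
def metric (S : E2 → E3) (x : E2) : Matrix (Fin 2) (Fin 2) ℝ :=
  Matrix.of fun i j => inner ℝ (covBasis S i x) (covBasis S j x)

/-- The matrix `b_ij = (∂g_i/∂xʲ, n)` of the curvature tensor `K = b_ij gⁱ ⊗ gʲ`. -/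
def secondForm (S : E2 → E3) (x : E2) : Matrix (Fin 2) (Fin 2) ℝ :=
  Matrix.of fun i j => inner ℝ (pderiv (covBasis S i) j x) (unitNormal S x)

/-- The contravariant basis `gⁱ = g^ij g_j`, with `[g^ij]` the inverse of `[g_ij]`. -/
def contraBasis (S : E2 → E3) (i : Fin 2) (x : E2) : E3 :=
  ∑ j, (metric S x)⁻¹ i j • covBasis S j x

/-- The mixed components `bⁱ_j = g^ik b_kj` of the curvature tensor `K = bⁱ_j g_i ⊗ gʲ`. -/
def curvatureMixed (S : E2 → E3) (x : E2) : Matrix (Fin 2) (Fin 2) ℝ :=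
  (metric S x)⁻¹ * secondForm S x

/-- The Gaussian curvature `K_G = det[b_ij] / det[g_ij]`. -/
def gaussCurvature (S : E2 → E3) (x : E2) : ℝ :=
  (secondForm S x).det / (metric S x).det

/-- The mixed components `L̂ⁱ_j` of `L̂ = |K| K⁻¹ = L̂ⁱ_j g_i ⊗ gʲ`, where `|K| = det[bⁱ_j]`. -/
def hatLMixed (S : E2 → E3) (x : E2) : Matrix (Fin 2) (Fin 2) ℝ :=
  (curvatureMixed S x).det • (curvatureMixed S x)⁻¹

/-- The contravariant components `L̂^ij = L̂ⁱ_k g^kj`. -/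
def hatLContra (S : E2 → E3) (x : E2) : Matrix (Fin 2) (Fin 2) ℝ :=
  hatLMixed S x * (metric S x)⁻¹

/-- The left contraction `a · L̂ = L̂ⁱ_j (a, g_i) gʲ` of a vector `a` with `L̂`. -/
def dotHatL (S : E2 → E3) (x : E2) (a : E3) : E3 :=
  ∑ i, ∑ j, (hatLMixed S x i j * inner ℝ a (covBasis S i x)) • contraBasis S j x

/-- `∇̄ ∘ Φ = L̂^ij g_i ∘ ∂Φ/∂xʲ`, for the differential operator `∇̄ = L̂^ij g_i ∂/∂xʲ` and a bilinear
operation `op` of vectors with tensors. -/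
def barNabla {p q : ℕ} (S : E2 → E3) (op : E3 →L[ℝ] Tensor p →L[ℝ] Tensor q)
    (Φ : E2 → Tensor p) (x : E2) : Tensor q :=
  ∑ i, ∑ j, hatLContra S x i j • op (covBasis S i x) (pderiv Φ j x)

/-- The surface integral `∫_Σ f dσ` over `Σ = S(D)`, with `dσ = √det[g_ij] dx¹ dx²`. -/
def surfaceIntegral {F : Type*} [NormedAddCommGroup F] [NormedSpace ℝ F]
    (S : E2 → E3) (D : Set E2) (f : E2 → F) : F :=
  ∫ x in D, Real.sqrt (metric S x).det • f x

/-- The line integral `∮ f(x, τ) dl` along the image under `S` of a closed plane curve, where `τ` is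
the unit tangent vector of the image curve and `dl` its arc length element. -/
def lineIntegral {F : Type*} [NormedAddCommGroup F] [NormedSpace ℝ F]
    (S : E2 → E3) (γ : ClosedCurve) (f : E2 → E3 → F) : F :=
  ∫ t in (0 : ℝ)..1, ‖deriv (S ∘ γ.toFun) t‖ •
    f (γ.toFun t) (‖deriv (S ∘ γ.toFun) t‖⁻¹ • deriv (S ∘ γ.toFun) t)

end

/-! The formula is Green's theorem for the one-form `(n × dn) ∘ Φ` on the parameter domain. With
indices 0, 1, J = |g_0 × g_1| and J² = det[g_ij], the Weingarten relations and the triple-product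
identity give J L̂^{0k} g_k = n × ∂_1 n and J L̂^{1k} g_k = -n × ∂_0 n. Hence ((τ × n) · L̂) dl
pulls back to n × dn (`dotHatL_cross_unitNormal`), and J ∇̄ ∘ Φ is the part of the curl in which Φ
is differentiated (`sqrt_smul_barNabla`). In the other part the second derivatives of n cancel,
leaving 2 ∂_0 n × ∂_1 n = 2 J K_G n (`curl_normalForm`, `cross_pderiv_unitNormal`).

Green's theorem is proved for boundaries described by winding numbers, without cutting up the
domain. A compactly supported one-form is recovered at a point c by integrating its curl and its
divergence against kernels of size 1/|c - z| (`oneForm_eq_integral`). Put c = γ(t), pair with γ'(t),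
integrate in t and apply Fubini. The curl kernel becomes 2π times the winding number around z. The
divergence kernel becomes the integral of d log|γ - z|, which is zero for z off the null set traced
by γ. So the line integral is the area integral of winding number times curl
(`ClosedCurve.integral_oneForm`), and the winding numbers add up to the indicator of D almost
everywhere. -/

/-- The unit vector at angle `θ`. -/
noncomputable def angleVec (θ : ℝ) : E2 := !₂[Real.cos θ, Real.sin θ]

/-- Rotation of the plane by a right angle. -/
def rotPlane (z : E2) : E2 := !₂[-z 1, z 0]

lemma continuous_angleVec : Continuous angleVec := by
  unfold angleVec; fun_prop

lemma continuous_rotPlane : Continuous rotPlane := by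
  unfold rotPlane; fun_prop

lemma norm_angleVec (θ : ℝ) : ‖angleVec θ‖ = 1 := by
  simp [angleVec, EuclideanSpace.norm_eq, Fin.sum_univ_two]

lemma norm_rotPlane (z : E2) : ‖rotPlane z‖ = ‖z‖ := by
  simp [rotPlane, EuclideanSpace.norm_eq, Fin.sum_univ_two, add_comm]

lemma rotPlane_smul (r : ℝ) (z : E2) : rotPlane (r • z) = r • rotPlane z := by
  ext i; fin_cases i <;> simp [rotPlane]

lemma hasDerivAt_angleVec (θ : ℝ) : HasDerivAt angleVec (rotPlane (angleVec θ)) θ := by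
  have h : HasDerivAt (fun θ : ℝ => ![Real.cos θ, Real.sin θ]) ![-Real.sin θ, Real.cos θ] θ := by
    rw [hasDerivAt_pi]
    intro i
    fin_cases i
    · exact Real.hasDerivAt_cos θ
    · exact Real.hasDerivAt_sin θ
  have := ((PiLp.continuousLinearEquiv 2 ℝ (fun _ : Fin 2 => ℝ)).symm : _ →L[ℝ] E2).hasFDerivAt.comp_hasDerivAt θ h
  refine (this.congr_deriv ?_).congr_of_eventuallyEq (Filter.Eventually.of_forall fun _ => rfl)
  ext i; fin_cases i <;> simp [rotPlane, angleVec]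

open MeasureTheory Set Real

/-! ### Singular integrals in polar coordinates -/

section Kernel

variable {F : Type*} [NormedAddCommGroup F] [NormedSpace ℝ F]

lemma integral_plane_eq_polar (f : E2 → F) :
    ∫ z, f z = ∫ p in Ioi (0 : ℝ) ×ˢ Ioo (-π) π, p.1 • f (p.1 • angleVec p.2) := by
  let e : (ℝ × ℝ) ≃ᵐ E2 :=
    MeasurableEquiv.finTwoArrow.symm.trans (MeasurableEquiv.toLp 2 (Fin 2 → ℝ))
  have he : MeasurePreserving e := by
    refine (PiLp.volume_preserving_toLp (Fin 2)).comp ?_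
    exact (volume_preserving_finTwoArrow ℝ).symm
  rw [← he.integral_comp e.measurableEmbedding f, ← integral_comp_polarCoord_symm]
  refine setIntegral_congr_fun polarCoord.open_target.measurableSet fun p _ => ?_
  have : e (polarCoord.symm p) = p.1 • angleVec p.2 := by
    ext i; fin_cases i <;> simp [e, angleVec]
  simp only [this]

/-- In the plane the polar Jacobian r cancels the singularity 1/r. -/
lemma integrable_indicator_inv_norm (R : ℝ) :
    Integrable ((Metric.closedBall (0 : E2) R).indicator fun z => ‖z‖⁻¹) := by
  have h := (integrable_fun_norm_addHaar (volume : Measure E2)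
    (f := (Iic R).indicator fun r : ℝ => r⁻¹)).2 ?_
  · refine h.congr (Filter.Eventually.of_forall fun z => ?_)
    by_cases hz : ‖z‖ ≤ R <;> simp [indicator, hz]
  · have : IntegrableOn ((Iic R).indicator fun _ => (1 : ℝ)) (Ioi 0) := by
      rw [IntegrableOn, integrable_indicator_iff measurableSet_Iic, IntegrableOn,
        Measure.restrict_restrict measurableSet_Iic, inter_comm, Ioi_inter_Iic]
      exact integrable_const _
    refine this.congr_fun (fun r hr => ?_) measurableSet_Ioi
    have hr0 : r ≠ 0 := (mem_Ioi.1 hr).ne'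
    by_cases h : r ≤ R <;> simp [indicator, h, hr0]

lemma integrableOn_polar {G : E2 → E2 →L[ℝ] F} (hG : Continuous G) (hc : HasCompactSupport G)
    {V : ℝ → E2} (hV : Continuous V) (w : E2) :
    IntegrableOn (fun p : ℝ × ℝ => G (w + p.1 • angleVec p.2) (V p.2))
      (Ioi (0 : ℝ) ×ˢ Ioo (-π) π) := by
  have hcont : Continuous fun p : ℝ × ℝ => G (w + p.1 • angleVec p.2) (V p.2) := by
    have := continuous_angleVec
    fun_prop
  obtain ⟨R, hR⟩ := hc.isCompact.isBounded.subset_closedBall w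
  have h2 : IntegrableOn (fun p : ℝ × ℝ => G (w + p.1 • angleVec p.2) (V p.2))
      (Icc (0 : ℝ) R ×ˢ Icc (-π) π) :=
    hcont.continuousOn.integrableOn_compact (isCompact_Icc.prod isCompact_Icc)
  refine h2.of_forall_sdiff_eq_zero (measurableSet_Ioi.prod measurableSet_Ioo) ?_
  rintro p ⟨⟨hp1, hp2⟩, hp3⟩
  by_contra hne
  refine hp3 ⟨⟨(mem_Ioi.1 hp1).le, ?_⟩, Ioo_subset_Icc_self hp2⟩
  have hne' : G (w + p.1 • angleVec p.2) ≠ 0 := fun h => hne (by rw [h]; rfl)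
  have := hR (subset_tsupport _ (Function.mem_support.2 hne'))
  rw [Metric.mem_closedBall, dist_eq_norm, add_sub_cancel_left, norm_smul, norm_angleVec,
    mul_one, norm_eq_abs] at this
  exact (le_abs_self _).trans this

/-- After the powers of r cancel, each ray carries an exact derivative in r, which integrates to `-P
w`; the angles contribute the factor 2π. -/
lemma integral_radial [CompleteSpace F] {P : E2 → F} (hP : ContDiff ℝ 1 P)
    (hc : HasCompactSupport P) (w : E2) :
    ∫ z, (‖z‖ ^ 2)⁻¹ • fderiv ℝ P (w + z) z = -(2 * π) • P w := by
  have hD : Continuous (fderiv ℝ P) := hP.continuous_fderiv one_ne_zero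
  rw [integral_plane_eq_polar]
  have h1 : ∀ p ∈ Ioi (0 : ℝ) ×ˢ Ioo (-π) π,
      p.1 • ((‖p.1 • angleVec p.2‖ ^ 2)⁻¹ •
        fderiv ℝ P (w + p.1 • angleVec p.2) (p.1 • angleVec p.2))
      = fderiv ℝ P (w + p.1 • angleVec p.2) (angleVec p.2) := by
    rintro p ⟨hp, -⟩
    have hp0 : p.1 ≠ 0 := (mem_Ioi.1 hp).ne'
    rw [norm_smul, norm_angleVec, mul_one, norm_eq_abs, sq_abs, map_smul, smul_smul, smul_smul]
    rw [show p.1 * (p.1 ^ 2)⁻¹ * p.1 = 1 by field_simp, one_smul]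
  rw [setIntegral_congr_fun (measurableSet_Ioi.prod measurableSet_Ioo) h1]
  have hint := integrableOn_polar hD (hc.fderiv (𝕜 := ℝ)) continuous_angleVec w
  have key : ∀ θ : ℝ,
      ∫ r in Ioi (0 : ℝ), fderiv ℝ P (w + r • angleVec θ) (angleVec θ) = - P w := by
    intro θ
    have hlin : ∀ r : ℝ, HasDerivAt (fun r : ℝ => w + r • angleVec θ) (angleVec θ) r := fun r => by
      simpa using ((hasDerivAt_id r).smul_const (angleVec θ)).const_add w
    have hd : ∀ r : ℝ, HasDerivAt (fun r : ℝ => P (w + r • angleVec θ))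
        (fderiv ℝ P (w + r • angleVec θ) (angleVec θ)) r := fun r =>
      ((hP.differentiable one_ne_zero).differentiableAt.hasFDerivAt).comp_hasDerivAt r (hlin r)
    have hcs : HasCompactSupport fun r : ℝ => P (w + r • angleVec θ) := by
      refine hc.comp_isClosedEmbedding (g := fun r : ℝ => w + r • angleVec θ) ?_
      refine Isometry.isClosedEmbedding (Isometry.of_dist_eq fun a b => ?_)
      rw [dist_add_left, dist_eq_norm, ← sub_smul, norm_smul, norm_angleVec, mul_one, dist_eq_norm]
    have := hcs.integral_Ioi_deriv_eq (hP.comp (by fun_prop)) 0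
    have hde : ∀ r, deriv (P ∘ fun r : ℝ => w + r • angleVec θ) r
        = fderiv ℝ P (w + r • angleVec θ) (angleVec θ) := fun r => (hd r).deriv
    simpa [hde] using this
  rw [Measure.volume_eq_prod] at hint ⊢
  rw [setIntegral_prod _ hint, integral_integral_swap]
  · simp_rw [key]
    simp only [integral_const, measureReal_restrict_apply_univ, volume_real_Ioo_of_le (neg_le_self pi_pos.le)]
    rw [smul_neg, neg_smul]
    congr 2
    ring
  · rw [Measure.prod_restrict]
    exact hint

/-- On each circle of radius r the integrand is the θ-derivative of r⁻¹ P(w + r e(θ)), a 2π-periodic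
function. -/
lemma integral_angular [CompleteSpace F] {P : E2 → F} (hP : ContDiff ℝ 1 P)
    (hc : HasCompactSupport P) (w : E2) :
    ∫ z, (‖z‖ ^ 2)⁻¹ • fderiv ℝ P (w + z) (rotPlane z) = 0 := by
  have hD : Continuous (fderiv ℝ P) := hP.continuous_fderiv one_ne_zero
  rw [integral_plane_eq_polar]
  have h1 : ∀ p ∈ Ioi (0 : ℝ) ×ˢ Ioo (-π) π,
      p.1 • ((‖p.1 • angleVec p.2‖ ^ 2)⁻¹ •
        fderiv ℝ P (w + p.1 • angleVec p.2) (rotPlane (p.1 • angleVec p.2)))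
      = fderiv ℝ P (w + p.1 • angleVec p.2) (rotPlane (angleVec p.2)) := by
    rintro p ⟨hp, -⟩
    have hp0 : p.1 ≠ 0 := (mem_Ioi.1 hp).ne'
    rw [norm_smul, norm_angleVec, mul_one, norm_eq_abs, sq_abs, rotPlane_smul, map_smul, smul_smul,
      smul_smul]
    rw [show p.1 * (p.1 ^ 2)⁻¹ * p.1 = 1 by field_simp, one_smul]
  rw [setIntegral_congr_fun (measurableSet_Ioi.prod measurableSet_Ioo) h1]
  have hV := continuous_rotPlane.comp continuous_angleVec
  have hint := integrableOn_polar hD (hc.fderiv (𝕜 := ℝ)) hV w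
  simp only [Function.comp_apply] at hint
  rw [Measure.volume_eq_prod] at hint ⊢
  rw [setIntegral_prod _ hint]
  refine setIntegral_eq_zero_of_forall_eq_zero fun r hr => ?_
  have hr0 : r ≠ 0 := (mem_Ioi.1 hr).ne'
  have hd : ∀ θ : ℝ, HasDerivAt (fun θ : ℝ => r⁻¹ • P (w + r • angleVec θ))
      (fderiv ℝ P (w + r • angleVec θ) (rotPlane (angleVec θ))) θ := fun θ => by
    have := (((hP.differentiable one_ne_zero).differentiableAt.hasFDerivAt).comp_hasDerivAt θ
      (((hasDerivAt_angleVec θ).const_smul r).const_add w)).const_smul r⁻¹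
    refine this.congr_deriv ?_
    rw [map_smul, smul_smul, inv_mul_cancel₀ hr0, one_smul]
    rfl
  rw [← integral_Ioc_eq_integral_Ioo, ← intervalIntegral.integral_of_le (neg_le_self pi_pos.le),
    intervalIntegral.integral_eq_sub_of_hasDerivAt (fun θ _ => hd θ)]
  · simp [angleVec]
  · have := continuous_angleVec
    have := continuous_rotPlane
    exact Continuous.intervalIntegrable (by fun_prop) _ _

end Kernel

/-! ### Piecewise C¹ closed curves: null trace, bounded velocity, winding integrals -/

namespace ClosedCurve

variable (γ : ClosedCurve)

lemma exists_no_breaks_near (t : ℝ) :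
    ∃ ε > 0, ∀ c ∈ γ.breaks, |c - t| < ε → c = t := by
  have h : (↑(γ.breaks.erase t) : Set ℝ)ᶜ ∈ nhds t :=
    (Finset.finite_toSet _).isClosed.isOpen_compl.mem_nhds (by simp)
  obtain ⟨ε, hε, hs⟩ := Metric.mem_nhds_iff.1 h
  refine ⟨ε, hε, fun c hc hct => ?_⟩
  by_contra hne
  exact hs (show c ∈ Metric.ball t ε by simpa [Real.dist_eq] using hct) (by simp [hne, hc])

/-- A property of sets of parameters holds on `[0, 1]` if it passes to subsets and unions and holds
for points and for intervals on which the curve is `C¹`. -/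
lemma piecewise_induction {p : Set ℝ → Prop} (hmono : ∀ ⦃s t⦄, s ⊆ t → p t → p s)
    (hunion : ∀ ⦃s t⦄, p s → p t → p (s ∪ t)) (hpt : ∀ t, p {t})
    (hpiece : ∀ a b, 0 ≤ a → a < b → b ≤ 1 → ContDiffOn ℝ 1 γ.toFun (Icc a b) → p (Icc a b)) :
    p (Icc 0 1) := by
  refine isCompact_Icc.induction_on (hmono (empty_subset {0}) (hpt 0)) hmono hunion ?_
  rintro t ⟨ht0, ht1⟩
  obtain ⟨ε, hε, hbr⟩ := γ.exists_no_breaks_near t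
  -- The point t may itself be a break, so the two sides of t are treated as separate C¹ pieces with
  -- t as an endpoint.
  have hleft : p (Icc (max 0 (t - ε)) t) := by
    rcases (max_le ht0 (by linarith) : max 0 (t - ε) ≤ t).eq_or_lt with h | h
    · rw [h, Icc_self]; exact hpt t
    · refine hpiece _ _ (le_max_left _ _) h ht1
        (γ.contDiffOn _ _ (le_max_left _ _) h ht1 fun c hc hcm => ?_)
      have h1 := (le_max_right 0 (t - ε)).trans_lt hcm.1
      exact hcm.2.ne (hbr c hc (by rw [abs_lt]; constructor <;> linarith [hcm.2]))
  have hright : p (Icc t (min 1 (t + ε))) := by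
    rcases (le_min ht1 (by linarith) : t ≤ min 1 (t + ε)).eq_or_lt with h | h
    · rw [← h, Icc_self]; exact hpt t
    · refine hpiece _ _ ht0 h (min_le_left _ _)
        (γ.contDiffOn _ _ ht0 h (min_le_left _ _) fun c hc hcm => ?_)
      have h1 := hcm.2.trans_le (min_le_right 1 (t + ε))
      exact hcm.1.ne' (hbr c hc (by rw [abs_lt]; constructor <;> linarith [hcm.1]))
  refine ⟨_, ?_, hunion hleft hright⟩
  refine mem_nhdsWithin.2 ⟨Ioo (t - ε) (t + ε), isOpen_Ioo, by constructor <;> linarith, ?_⟩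
  rintro s ⟨⟨h1, h2⟩, h3, h4⟩
  rcases le_total s t with h | h
  · exact Or.inl ⟨max_le h3 h1.le, h⟩
  · exact Or.inr ⟨h, le_min h4 h2.le⟩

/-- The parameters at which the curve is differentiable for sure. -/
def regularSet : Set ℝ := Ioo 0 1 \ γ.breaks

lemma measurableSet_regularSet : MeasurableSet γ.regularSet :=
  measurableSet_Ioo.diff (Finset.measurableSet _)

lemma ae_mem_regularSet : ∀ᵐ t ∂(volume.restrict (Ioc (0 : ℝ) 1)), t ∈ γ.regularSet := by
  rw [← restrict_Ioo_eq_restrict_Ioc]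
  have h : ∀ᵐ t ∂(volume.restrict (Ioo (0 : ℝ) 1)), t ∉ (γ.breaks : Set ℝ) :=
    ae_restrict_of_ae (measure_eq_zero_iff_ae_notMem.1 (Finset.measure_zero _ _))
  filter_upwards [h, ae_restrict_mem measurableSet_Ioo] with t h1 h2 using ⟨h2, h1⟩

lemma differentiableAt {t : ℝ} (ht : t ∈ γ.regularSet) : DifferentiableAt ℝ γ.toFun t := by
  obtain ⟨⟨h0, h1⟩, hb⟩ := ht
  obtain ⟨ε, hε, hbr⟩ := γ.exists_no_breaks_near t
  have ha : max 0 (t - ε) < t := max_lt h0 (by linarith)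
  have hb' : t < min 1 (t + ε) := lt_min h1 (by linarith)
  refine ((γ.contDiffOn (max 0 (t - ε)) (min 1 (t + ε)) (le_max_left _ _) (ha.trans hb')
    (min_le_left _ _) fun c hc hcm => ?_).differentiableOn one_ne_zero).differentiableAt
    (Icc_mem_nhds ha hb')
  have h2 := (le_max_right 0 (t - ε)).trans_lt hcm.1
  have h3 := hcm.2.trans_le (min_le_right 1 (t + ε))
  have := hbr c hc (by rw [abs_lt]; constructor <;> linarith)
  exact hb (this ▸ hc)

lemma exists_norm_deriv_le : ∃ C, ∀ t ∈ γ.regularSet, ‖deriv γ.toFun t‖ ≤ C := by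
  suffices h : ∃ C, ∀ t ∈ Icc (0 : ℝ) 1, t ∈ γ.regularSet → ‖deriv γ.toFun t‖ ≤ C by
    obtain ⟨C, hC⟩ := h
    exact ⟨C, fun t ht => hC t (Ioo_subset_Icc_self ht.1) ht⟩
  refine γ.piecewise_induction
    (p := fun s => ∃ C, ∀ t ∈ s, t ∈ γ.regularSet → ‖deriv γ.toFun t‖ ≤ C) ?_ ?_ ?_ ?_
  · rintro s t hst ⟨C, hC⟩
    exact ⟨C, fun x hx => hC x (hst hx)⟩
  · rintro s t ⟨C, hC⟩ ⟨C', hC'⟩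
    refine ⟨max C C', fun x hx hr => ?_⟩
    rcases hx with hx | hx
    · exact (hC x hx hr).trans (le_max_left _ _)
    · exact (hC' x hx hr).trans (le_max_right _ _)
  · rintro t
    exact ⟨‖deriv γ.toFun t‖, fun x hx _ => by rw [mem_singleton_iff.1 hx]⟩
  · intro a b _ hab _ hcd
    have hu : UniqueDiffOn ℝ (Icc a b) := uniqueDiffOn_Icc hab
    obtain ⟨C, hC⟩ := isCompact_Icc.exists_bound_of_continuousOn
      (hcd.continuousOn_derivWithin hu le_rfl)
    refine ⟨C, fun t ht hr => ?_⟩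
    rw [← (γ.differentiableAt hr).derivWithin (hu t ht)]
    exact hC t ht

/-- A C¹ image of an interval has Hausdorff dimension at most 1, hence zero two-dimensional
Hausdorff measure; that measure is a Haar measure on the plane, so Lebesgue measure is absolutely
continuous with respect to it. -/
lemma volume_trace : volume γ.trace = 0 := by
  refine γ.piecewise_induction (p := fun s => volume (γ.toFun '' s) = 0) ?_ ?_ ?_ ?_
  · intro s t hst ht
    exact measure_mono_null (image_mono hst) ht
  · intro s t hs ht
    rw [image_union]
    exact measure_union_null hs ht
  · intro t
    simp
  · intro a b _ hab _ hcd
    have hd : dimH (γ.toFun '' Icc a b) ≤ 1 := by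
      refine (hcd.dimH_image_le (convex_Icc a b) subset_rfl).trans ?_
      refine (dimH_mono (subset_univ _)).trans (le_of_eq ?_)
      rw [Real.dimH_univ]
    have h2 : (Measure.hausdorffMeasure (2 : NNReal) : Measure E2) (γ.toFun '' Icc a b) = 0 :=
      hausdorffMeasure_of_dimH_lt (hd.trans_lt (by norm_num))
    have h3 := isAddHaarMeasure_hausdorffMeasure (E := E2)
    have h4 : (volume : Measure E2) ≪ Measure.hausdorffMeasure (Module.finrank ℝ E2) :=
      Measure.absolutelyContinuous_isAddHaarMeasure _ _
    refine h4 ?_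
    simpa using h2

/-- The velocity of the curve, set to zero where the curve may have corners. -/
noncomputable def velocity (t : ℝ) : E2 := γ.regularSet.indicator (deriv γ.toFun) t

lemma measurable_velocity : Measurable γ.velocity :=
  (measurable_deriv _).indicator γ.measurableSet_regularSet

lemma velocity_of_mem {t : ℝ} (ht : t ∈ γ.regularSet) : γ.velocity t = deriv γ.toFun t :=
  indicator_of_mem ht _

lemma exists_norm_velocity_le : ∃ C, ∀ t, ‖γ.velocity t‖ ≤ C := by
  obtain ⟨C, hC⟩ := γ.exists_norm_deriv_le
  refine ⟨max C 0, fun t => ?_⟩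
  by_cases ht : t ∈ γ.regularSet
  · rw [γ.velocity_of_mem ht]
    exact (hC t ht).trans (le_max_left _ _)
  · simp [velocity, indicator_of_notMem ht]

/-- A continuous extension of the curve to the real line. -/
noncomputable def extend : ℝ → E2 := IccExtend zero_le_one ((Icc 0 1).domRestrict γ.toFun)

lemma continuous_extend : Continuous γ.extend :=
  γ.continuousOn.domRestrict.Icc_extend'

lemma extend_of_mem {t : ℝ} (ht : t ∈ Icc (0 : ℝ) 1) : γ.extend t = γ.toFun t :=
  IccExtend_of_mem _ _ ht

lemma exists_norm_extend_le : ∃ C, ∀ t, ‖γ.extend t‖ ≤ C := by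
  obtain ⟨C, hC⟩ := isCompact_Icc.exists_bound_of_continuousOn γ.continuousOn
  refine ⟨C, fun t => ?_⟩
  exact hC _ (projIcc 0 1 zero_le_one t).2

lemma intervalIntegral_congr_regular {F : Type*} [NormedAddCommGroup F] [NormedSpace ℝ F]
    {f g : ℝ → F} (h : ∀ t ∈ γ.regularSet, f t = g t) :
    ∫ t in (0 : ℝ)..1, f t = ∫ t in (0 : ℝ)..1, g t := by
  rw [intervalIntegral.integral_of_le zero_le_one, intervalIntegral.integral_of_le zero_le_one]
  refine integral_congr_ae ?_
  filter_upwards [γ.ae_mem_regularSet] with t ht using h t ht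

lemma extend_of_regular {t : ℝ} (ht : t ∈ γ.regularSet) : γ.extend t = γ.toFun t :=
  γ.extend_of_mem (Ioo_subset_Icc_self ht.1)

lemma integrable_of_bound {F : Type*} [NormedAddCommGroup F] [NormedSpace ℝ F]
    {f : ℝ → F} (hf : AEStronglyMeasurable f (volume.restrict (Ioc (0 : ℝ) 1))) {C : ℝ}
    (h : ∀ t ∈ γ.regularSet, ‖f t‖ ≤ C) : Integrable f (volume.restrict (Ioc (0 : ℝ) 1)) := by
  refine Integrable.of_bound hf C ?_
  filter_upwards [γ.ae_mem_regularSet] with t ht using h t ht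

/-- The logarithmic differential of the distance to a point integrates to zero. -/
lemma integral_log_differential {z : E2} (hz : z ∉ γ.trace) :
    ∫ t in (0 : ℝ)..1, inner ℝ (γ.extend t - z) (γ.velocity t) / ‖γ.extend t - z‖ ^ 2 = 0 := by
  have hne : ∀ t, γ.extend t - z ≠ 0 := fun t h =>
    hz ⟨projIcc 0 1 zero_le_one t, (projIcc 0 1 zero_le_one t).2, sub_eq_zero.1 h⟩
  have hpos : ∀ t, 0 < ‖γ.extend t - z‖ := fun t => norm_pos_iff.2 (hne t)
  have hcont := γ.continuous_extend
  have hcn : Continuous fun t => ‖γ.extend t - z‖ ^ 2 := by fun_prop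
  -- The antiderivative is log‖γ - z‖, written as half the logarithm of the smooth squared norm.
  have hderiv : ∀ t ∈ γ.regularSet, HasDerivAt (fun t => Real.log (‖γ.extend t - z‖ ^ 2) / 2)
      (inner ℝ (γ.extend t - z) (γ.velocity t) / ‖γ.extend t - z‖ ^ 2) t := by
    intro t ht
    have h1 : HasDerivAt γ.extend (γ.velocity t) t := by
      rw [γ.velocity_of_mem ht]
      refine (γ.differentiableAt ht).hasDerivAt.congr_of_eventuallyEq ?_
      filter_upwards [Ioo_mem_nhds ht.1.1 ht.1.2] with s hs
      exact γ.extend_of_mem (Ioo_subset_Icc_self hs)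
    have h2 := ((h1.sub_const z).norm_sq.log (pow_pos (hpos t) 2).ne').div_const 2
    refine h2.congr_deriv ?_
    ring
  have hint : IntervalIntegrable (fun t => inner ℝ (γ.extend t - z) (γ.velocity t) /
      ‖γ.extend t - z‖ ^ 2) volume 0 1 := by
    rw [intervalIntegrable_iff_integrableOn_Ioc_of_le zero_le_one]
    obtain ⟨C, hC⟩ := γ.exists_norm_velocity_le
    have hinv : ContinuousOn (fun t => ‖γ.extend t - z‖⁻¹) (Icc 0 1) :=
      (Continuous.inv₀ (by fun_prop) fun t => (hpos t).ne').continuousOn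
    obtain ⟨M, hM⟩ := isCompact_Icc.exists_bound_of_continuousOn hinv
    refine γ.integrable_of_bound (C := M * C) ?_ fun t ht => ?_
    · have := γ.measurable_velocity
      exact (((hcont.measurable.sub_const z).inner this).div hcn.measurable).aestronglyMeasurable
    · rw [norm_div, norm_pow, norm_norm, div_le_iff₀ (pow_pos (hpos t) 2)]
      have hM' := hM t (Ioo_subset_Icc_self ht.1)
      rw [norm_inv, norm_norm, inv_le_iff_one_le_mul₀ (hpos t)] at hM'
      calc ‖inner ℝ (γ.extend t - z) (γ.velocity t)‖
          ≤ ‖γ.extend t - z‖ * ‖γ.velocity t‖ := norm_inner_le_norm _ _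
        _ ≤ ‖γ.extend t - z‖ * C := by gcongr; exact hC t
        _ = 1 * (C * ‖γ.extend t - z‖) := by ring
        _ ≤ (M * ‖γ.extend t - z‖) * (C * ‖γ.extend t - z‖) := by
            have : 0 ≤ C := (norm_nonneg _).trans (hC t)
            gcongr
        _ = M * C * ‖γ.extend t - z‖ ^ 2 := by ring
  -- At the finitely many breaks continuity of the antiderivative suffices.
  rw [integral_eq_of_hasDerivAt_off_countable
    (fun t => Real.log (‖γ.extend t - z‖ ^ 2) / 2) _ (s := γ.breaks) (Finset.countable_toSet _)
    (Continuous.continuousOn ?_) ?_ hint]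
  · rw [γ.extend_of_mem (by simp), γ.extend_of_mem (by simp), γ.closed, sub_self]
  · exact (hcn.log fun t => (pow_pos (hpos t) 2).ne').div_const 2
  · intro t ht
    rw [min_eq_left zero_le_one, max_eq_right zero_le_one] at ht
    exact hderiv t ht

/-- The determinant in the winding integrand is the pairing of the velocity with the rotated radius
vector. The integrands agree at all regular parameters, so z may even lie on the trace. -/
lemma winding_eq (z : E2) :
    2 * π * γ.winding z = ∫ t in (0 : ℝ)..1,
      inner ℝ (rotPlane (γ.extend t - z)) (γ.velocity t) / ‖γ.extend t - z‖ ^ 2 := by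
  rw [winding, ← mul_assoc, mul_inv_cancel₀ (by positivity), one_mul]
  refine γ.intervalIntegral_congr_regular fun t ht => ?_
  rw [γ.extend_of_regular ht, γ.velocity_of_mem ht]
  congr 1
  simp [rotPlane, PiLp.inner_apply, Fin.sum_univ_two]
  ring

end ClosedCurve

/-! ### Kernel representation of one-forms and Green's theorem for one curve -/

section PlaneKernel

variable {F : Type*} [NormedAddCommGroup F] [NormedSpace ℝ F]

lemma fderiv_eq_pderiv (P : E2 → F) (w z : E2) :
    fderiv ℝ P w z = z 0 • pderiv P 0 w + z 1 • pderiv P 1 w := by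
  have hz : z = z 0 • EuclideanSpace.single 0 1 + z 1 • EuclideanSpace.single 1 1 := by
    ext i; fin_cases i <;> simp
  conv_lhs => rw [hz]
  rw [map_add, map_smul, map_smul, pderiv, pderiv]

lemma continuous_pderiv {P : E2 → F} (hP : ContDiff ℝ 1 P) (i : Fin 2) :
    Continuous (pderiv P i) :=
  (hP.continuous_fderiv one_ne_zero).clm_apply continuous_const

lemma hasCompactSupport_pderiv {P : E2 → F} (hP : HasCompactSupport P) (i : Fin 2) :
    HasCompactSupport (pderiv P i) :=
  hP.fderiv_apply (𝕜 := ℝ) _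

omit [NormedSpace ℝ F] in
lemma exists_bound_compactSupport {h : E2 → F} (hh : Continuous h) (hc : HasCompactSupport h) :
    ∃ M R, 0 ≤ M ∧ ∀ z, ‖h z‖ ≤ (Metric.closedBall (0 : E2) R).indicator (fun _ => M) z := by
  obtain ⟨M, hM⟩ := hh.bounded_above_of_compact_support hc
  obtain ⟨R, hR⟩ := hc.isCompact.isBounded.subset_closedBall 0
  refine ⟨max M 0, R, le_max_right _ _, fun z => ?_⟩
  by_cases hz : z ∈ Metric.closedBall (0 : E2) R
  · rw [indicator_of_mem hz]
    exact (hM z).trans (le_max_left _ _)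
  · rw [indicator_of_notMem hz, image_eq_zero_of_notMem_tsupport (fun h => hz (hR h)), norm_zero]

lemma norm_inner_div_le {ζ a : E2} (v : E2) (ha : ‖a‖ = ‖ζ‖) :
    |inner ℝ a v / ‖ζ‖ ^ 2| ≤ ‖v‖ * ‖ζ‖⁻¹ := by
  rw [abs_div, abs_of_nonneg (sq_nonneg ‖ζ‖)]
  rcases (norm_nonneg ζ).eq_or_lt with h | h
  -- At ζ = 0 both sides are zero by the convention for division by zero.
  · simp [← h]
  · rw [div_le_iff₀ (by positivity)]
    calc |inner ℝ a v| ≤ ‖a‖ * ‖v‖ := abs_real_inner_le_norm _ _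
      _ = ‖v‖ * ‖ζ‖⁻¹ * ‖ζ‖ ^ 2 := by rw [ha]; field_simp

omit [NormedSpace ℝ F] in
lemma integrable_of_norm_le_inv {g : E2 → F} (hg : AEStronglyMeasurable g) {M R : ℝ} (c : E2)
    (h : ∀ z, ‖g z‖ ≤ M * (Metric.closedBall (0 : E2) R).indicator (fun z => ‖z‖⁻¹) (c - z)) :
    Integrable g :=
  (((integrable_indicator_inv_norm R).comp_sub_left c).const_mul M).mono' hg
    (Filter.Eventually.of_forall h)

/-- Kernels of size `‖ζ‖⁻¹`, paired with a velocity and a compactly supported density. -/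
lemma norm_kernel_le {h : E2 → F} {M R R₀ C : ℝ} (hM : 0 ≤ M)
    (hh : ∀ z, ‖h z‖ ≤ (Metric.closedBall (0 : E2) R).indicator (fun _ => M) z)
    {V : E2 → E2} (hV : ∀ z, ‖V z‖ = ‖z‖) {c v : E2} (hc : ‖c‖ ≤ R₀) (hv : ‖v‖ ≤ C) (z : E2) :
    ‖(inner ℝ (V (c - z)) v / ‖c - z‖ ^ 2) • h z‖ ≤
      (C * M) * (Metric.closedBall (0 : E2) (R₀ + R)).indicator (fun z => ‖z‖⁻¹) (c - z) := by
  by_cases hz : z ∈ Metric.closedBall (0 : E2) R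
  · have hh' := hh z
    rw [indicator_of_mem hz] at hh'
    rw [indicator_of_mem, norm_smul, norm_eq_abs]
    · calc |inner ℝ (V (c - z)) v / ‖c - z‖ ^ 2| * ‖h z‖
          ≤ (‖v‖ * ‖c - z‖⁻¹) * M := by
            gcongr
            exact norm_inner_div_le v (hV _)
        _ ≤ (C * ‖c - z‖⁻¹) * M := by
            have := (norm_nonneg _).trans hh'
            gcongr
        _ = C * M * ‖c - z‖⁻¹ := by ring
    · rw [mem_closedBall_zero_iff] at hz ⊢
      exact (norm_sub_le _ _).trans (add_le_add hc hz)
  · have hh' := hh z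
    rw [indicator_of_notMem hz] at hh'
    rw [norm_le_zero_iff.1 hh', smul_zero, norm_zero]
    refine mul_nonneg (mul_nonneg ((norm_nonneg _).trans hv) hM) (indicator_nonneg ?_ _)
    intro z _
    positivity

lemma integrable_kernel {h : E2 → F} (hh : Continuous h) (hc : HasCompactSupport h)
    {V : E2 → E2} (hVc : Continuous V) (hV : ∀ z, ‖V z‖ = ‖z‖) (c v : E2) :
    Integrable fun z => (inner ℝ (V (c - z)) v / ‖c - z‖ ^ 2) • h z := by
  obtain ⟨M, R, hM, hb⟩ := exists_bound_compactSupport hh hc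
  refine integrable_of_norm_le_inv ?_ c (norm_kernel_le hM hb hV le_rfl (le_refl ‖v‖))
  refine AEStronglyMeasurable.smul ?_ hh.aestronglyMeasurable
  refine Measurable.aestronglyMeasurable ?_
  exact Measurable.div (by fun_prop) (by fun_prop)

/-- This justifies Fubini: the kernel is dominated by a multiple of 1/|γ(t) - z| on a ball, whose
integral in z does not depend on t. -/
lemma integrable_kernel_prod (γ : ClosedCurve) {h : E2 → F} (hh : Continuous h)
    (hc : HasCompactSupport h) {V : E2 → E2} (hVc : Continuous V) (hV : ∀ z, ‖V z‖ = ‖z‖) :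
    Integrable (fun p : ℝ × E2 => (inner ℝ (V (γ.extend p.1 - p.2)) (γ.velocity p.1) /
      ‖γ.extend p.1 - p.2‖ ^ 2) • h p.2) ((volume.restrict (Ioc (0 : ℝ) 1)).prod volume) := by
  obtain ⟨M, R, hM, hb⟩ := exists_bound_compactSupport hh hc
  obtain ⟨C, hC⟩ := γ.exists_norm_velocity_le
  obtain ⟨R₀, hR₀⟩ := γ.exists_norm_extend_le
  have hmeas : AEStronglyMeasurable (fun p : ℝ × E2 =>
      (inner ℝ (V (γ.extend p.1 - p.2)) (γ.velocity p.1) / ‖γ.extend p.1 - p.2‖ ^ 2) • h p.2)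
      ((volume.restrict (Ioc (0 : ℝ) 1)).prod volume) := by
    have h1 := γ.continuous_extend
    have h2 := γ.measurable_velocity
    refine AEStronglyMeasurable.smul ?_ (hh.comp continuous_snd).aestronglyMeasurable
    refine Measurable.aestronglyMeasurable ?_
    have h3 : Measurable fun p : ℝ × E2 => V (γ.extend p.1 - p.2) :=
      Continuous.measurable (by fun_prop)
    exact (h3.inner (h2.comp measurable_fst)).div (Continuous.measurable (by fun_prop))
  have hint : ∀ t, Integrable fun z =>
      (inner ℝ (V (γ.extend t - z)) (γ.velocity t) / ‖γ.extend t - z‖ ^ 2) • h z := fun t =>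
    integrable_kernel hh hc hVc hV _ _
  refine (integrable_prod_iff hmeas).2 ⟨Filter.Eventually.of_forall hint, ?_⟩
  refine Integrable.of_bound hmeas.norm.integral_prod_right'
    (∫ z, (C * M) * (Metric.closedBall (0 : E2) (R₀ + R)).indicator (fun z => ‖z‖⁻¹) z)
    (Filter.Eventually.of_forall fun t => ?_)
  rw [norm_of_nonneg (integral_nonneg fun _ => norm_nonneg _)]
  -- The substitution z ↦ γ(t) - z makes the dominating integral comparable to a constant
  -- independent of t.
  rw [← integral_sub_left_eq_self (fun z => (C * M) *
    (Metric.closedBall (0 : E2) (R₀ + R)).indicator (fun z => ‖z‖⁻¹) z) volume (γ.extend t)]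
  have hdom := ((integrable_indicator_inv_norm (R₀ + R)).const_mul (C * M)).comp_sub_left
    (γ.extend t)
  refine integral_mono (hint t).norm hdom fun z => ?_
  exact norm_kernel_le hM hb hV (hR₀ t) (hC t) z

/-- Representation of a compactly supported one-form through its curl and its divergence. -/
lemma oneForm_eq_integral [CompleteSpace F] {P Q : E2 → F} (hP : ContDiff ℝ 1 P)
    (hQ : ContDiff ℝ 1 Q) (hPc : HasCompactSupport P) (hQc : HasCompactSupport Q) (c v : E2) :
    (2 * π) • (v 0 • P c + v 1 • Q c) =
      (∫ z, (inner ℝ (rotPlane (c - z)) v / ‖c - z‖ ^ 2) • (pderiv Q 0 z - pderiv P 1 z)) +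
      ∫ z, (inner ℝ (c - z) v / ‖c - z‖ ^ 2) • (pderiv P 0 z + pderiv Q 1 z) := by
  have hi : ∀ {G : E2 → F}, ContDiff ℝ 1 G → HasCompactSupport G → ∀ {V : E2 → E2},
      Continuous V → (∀ z, ‖V z‖ = ‖z‖) →
      Integrable fun z => (‖z‖ ^ 2)⁻¹ • fderiv ℝ G (c + z) (V z) := by
    intro G hG hGc V hVc hV
    have hbase : ∀ i : Fin 2, Integrable fun z =>
        ((V z) i / ‖z‖ ^ 2) • pderiv G i (c + z) := by
      intro i
      -- The shift z ↦ c + z turns c - z into -z; the reflected field `V (-z)` absorbs this sign.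
      have := (integrable_kernel (continuous_pderiv hG i) (hasCompactSupport_pderiv hGc i)
        (V := fun z => V (-z)) (hVc.comp continuous_neg) (fun z => by rw [hV, norm_neg]) c
        (EuclideanSpace.single i 1)).comp_add_left c
      simpa [EuclideanSpace.inner_single_right] using this
    refine ((hbase 0).add (hbase 1)).congr (Filter.Eventually.of_forall fun z => ?_)
    simp only [Pi.add_apply]
    rw [fderiv_eq_pderiv, smul_add, smul_smul, smul_smul, div_eq_inv_mul, div_eq_inv_mul]
  have e1 := integral_radial hP hPc c
  have e2 := integral_radial hQ hQc c
  have e3 := integral_angular hP hPc c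
  have e4 := integral_angular hQ hQc c
  have i1 : Integrable (fun z => v 0 • (‖z‖ ^ 2)⁻¹ • fderiv ℝ P (c + z) (z)) :=
    (hi hP hPc continuous_id (fun _ => rfl)).smul (v 0)
  have i2 : Integrable (fun z => v 1 • (‖z‖ ^ 2)⁻¹ • fderiv ℝ Q (c + z) (z)) :=
    (hi hQ hQc continuous_id (fun _ => rfl)).smul (v 1)
  have i3 : Integrable (fun z => v 1 • (‖z‖ ^ 2)⁻¹ • fderiv ℝ P (c + z) (rotPlane z)) :=
    (hi hP hPc continuous_rotPlane norm_rotPlane).smul (v 1)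
  have i4 : Integrable (fun z => v 0 • (‖z‖ ^ 2)⁻¹ • fderiv ℝ Q (c + z) (rotPlane z)) :=
    (hi hQ hQc continuous_rotPlane norm_rotPlane).smul (v 0)
  rw [← integral_add
    (integrable_kernel (h := fun z => pderiv Q 0 z - pderiv P 1 z)
      ((continuous_pderiv hQ 0).sub (continuous_pderiv hP 1))
      ((hasCompactSupport_pderiv hQc 0).sub (hasCompactSupport_pderiv hPc 1))
      continuous_rotPlane norm_rotPlane c v)
    (integrable_kernel (h := fun z => pderiv P 0 z + pderiv Q 1 z) (V := fun z => z)
      ((continuous_pderiv hP 0).add (continuous_pderiv hQ 1))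
      ((hasCompactSupport_pderiv hPc 0).add (hasCompactSupport_pderiv hQc 1))
      continuous_id (fun _ => rfl) c v)]
  rw [← integral_add_left_eq_self _ c]
  -- The curl and divergence terms regroup into radial and angular derivatives of P and Q. The
  -- radial ones yield the values at c, the angular ones vanish.
  have hpt : ∀ z : E2,
      (inner ℝ (rotPlane (c - (c + z))) v / ‖c - (c + z)‖ ^ 2) •
          (pderiv Q 0 (c + z) - pderiv P 1 (c + z)) +
        (inner ℝ (c - (c + z)) v / ‖c - (c + z)‖ ^ 2) •
          (pderiv P 0 (c + z) + pderiv Q 1 (c + z)) =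
      -((v 0 • (‖z‖ ^ 2)⁻¹ • fderiv ℝ P (c + z) z + v 1 • (‖z‖ ^ 2)⁻¹ • fderiv ℝ Q (c + z) z) +
        (v 0 • (‖z‖ ^ 2)⁻¹ • fderiv ℝ Q (c + z) (rotPlane z) -
          v 1 • (‖z‖ ^ 2)⁻¹ • fderiv ℝ P (c + z) (rotPlane z))) := by
    intro z
    simp only [fderiv_eq_pderiv, sub_add_cancel_left, norm_neg, div_eq_inv_mul]
    simp only [rotPlane, PiLp.inner_apply, Fin.sum_univ_two]
    simp
    module
  simp_rw [hpt]
  have h12 := i1.add i2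
  have h43 := i4.sub i3
  simp only [Pi.add_def, Pi.sub_def] at h12 h43
  rw [integral_neg, integral_add h12 h43, integral_add i1 i2, integral_sub i4 i3]
  simp only [integral_smul]
  rw [e1, e2, e3, e4]
  module

/-- Green's theorem for one closed curve and a compactly supported one-form: the winding number is
the density of the area integral. -/
theorem ClosedCurve.integral_oneForm [CompleteSpace F] (γ : ClosedCurve) {P Q : E2 → F}
    (hP : ContDiff ℝ 1 P) (hQ : ContDiff ℝ 1 Q) (hPc : HasCompactSupport P)
    (hQc : HasCompactSupport Q) :
    Integrable (fun z => γ.winding z • (pderiv Q 0 z - pderiv P 1 z)) ∧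
    ∫ t in (0 : ℝ)..1, ((deriv γ.toFun t) 0 • P (γ.toFun t) + (deriv γ.toFun t) 1 • Q (γ.toFun t))
      = ∫ z, γ.winding z • (pderiv Q 0 z - pderiv P 1 z) := by
  have i1 := integrable_kernel_prod γ (h := fun z => pderiv Q 0 z - pderiv P 1 z)
      ((continuous_pderiv hQ 0).sub (continuous_pderiv hP 1))
      ((hasCompactSupport_pderiv hQc 0).sub (hasCompactSupport_pderiv hPc 1))
      continuous_rotPlane norm_rotPlane
  have i2 := integrable_kernel_prod γ (h := fun z => pderiv P 0 z + pderiv Q 1 z) (V := fun z => z)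
      ((continuous_pderiv hP 0).add (continuous_pderiv hQ 1))
      ((hasCompactSupport_pderiv hPc 0).add (hasCompactSupport_pderiv hQc 1))
      continuous_id (fun _ => rfl)
  have h2π : (2 * π) ≠ 0 := by positivity
  have hcurl : ∀ z, ∫ t in Ioc (0 : ℝ) 1, (inner ℝ (rotPlane (γ.extend t - z)) (γ.velocity t) /
      ‖γ.extend t - z‖ ^ 2) • (pderiv Q 0 z - pderiv P 1 z)
      = (2 * π) • (γ.winding z • (pderiv Q 0 z - pderiv P 1 z)) := by
    intro z
    rw [integral_smul_const, ← intervalIntegral.integral_of_le zero_le_one, ← γ.winding_eq,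
      mul_smul]
  -- Only almost every z is claimed: log|γ - z| is singular for z on the trace, a null set.
  have hdiv : ∀ᵐ z, ∫ t in Ioc (0 : ℝ) 1, (inner ℝ (γ.extend t - z) (γ.velocity t) /
      ‖γ.extend t - z‖ ^ 2) • (pderiv P 0 z + pderiv Q 1 z) = 0 := by
    filter_upwards [measure_eq_zero_iff_ae_notMem.1 γ.volume_trace] with z hz
    rw [integral_smul_const, ← intervalIntegral.integral_of_le zero_le_one,
      γ.integral_log_differential hz, zero_smul]
  constructor
  · have h := i1.integral_prod_right
    simp only [hcurl] at h
    refine (h.smul (2 * π)⁻¹).congr (Filter.Eventually.of_forall fun z => ?_)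
    simp only [Pi.smul_apply]
    rw [smul_smul, inv_mul_cancel₀ h2π, one_smul]
  · rw [γ.intervalIntegral_congr_regular
      (g := fun t => (γ.velocity t) 0 • P (γ.extend t) + (γ.velocity t) 1 • Q (γ.extend t))
      fun t ht => by rw [γ.extend_of_regular ht, γ.velocity_of_mem ht]]
    refine smul_right_injective F h2π ?_
    simp only
    rw [← intervalIntegral.integral_smul, intervalIntegral.integral_of_le zero_le_one]
    simp_rw [oneForm_eq_integral hP hQ hPc hQc]
    have j1 := i1.integral_prod_left
    have j2 := i2.integral_prod_left
    simp only at j1 j2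
    have s1 := integral_integral_swap (f := fun t z =>
      (inner ℝ (rotPlane (γ.extend t - z)) (γ.velocity t) / ‖γ.extend t - z‖ ^ 2) •
        (pderiv Q 0 z - pderiv P 1 z)) i1
    have s2 := integral_integral_swap (f := fun t z =>
      (inner ℝ (γ.extend t - z) (γ.velocity t) / ‖γ.extend t - z‖ ^ 2) •
        (pderiv P 0 z + pderiv Q 1 z)) i2
    rw [integral_add j1 j2, s1, s2, integral_congr_ae hdiv, integral_zero, add_zero]
    simp_rw [hcurl]
    rw [integral_smul]

end PlaneKernel

/-! ### Green's theorem for a domain with oriented boundary -/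

section Green

variable {F : Type*} [NormedAddCommGroup F] [NormedSpace ℝ F]

/-- A `C¹` function near a compact set agrees near it with a compactly supported one. -/
lemma exists_contDiff_compactSupport_eq_near {D U : Set E2} (hD : IsCompact D) (hU : IsOpen U)
    (hDU : D ⊆ U) {P : E2 → F} (hP : ContDiffOn ℝ 1 P U) :
    ∃ P' : E2 → F, ContDiff ℝ 1 P' ∧ HasCompactSupport P' ∧ ∀ x ∈ D, P' =ᶠ[nhds x] P := by
  obtain ⟨K, hK, hDK, hKU⟩ := exists_compact_between hD hU hDU
  -- The cutoff is 1 near D and 0 off K, so χP is C¹ on the whole plane although P is controlled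
  -- only on U.
  obtain ⟨χ, hχ1, hχ0, -⟩ := exists_contMDiffMap_one_nhds_of_subset_interior (n := 1)
    (modelWithCornersSelf ℝ E2) hD.isClosed hDK
  have hχ : ContDiff ℝ 1 χ := χ.contMDiff.contDiff
  refine ⟨fun x => χ x • P x, ?_, ?_, fun x hx => ?_⟩
  · rw [contDiff_iff_contDiffAt]
    intro x
    by_cases hx : x ∈ K
    · exact hχ.contDiffAt.smul (hP.contDiffAt (hU.mem_nhds (hKU hx)))
    · refine (contDiffAt_const (c := (0 : F))).congr_of_eventuallyEq ?_
      filter_upwards [hK.isClosed.isOpen_compl.mem_nhds hx] with y hy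
      rw [hχ0 y hy, zero_smul]
  · refine HasCompactSupport.intro hK fun x hx => ?_
    rw [hχ0 x hx, zero_smul]
  · filter_upwards [hχ1.filter_mono (nhds_le_nhdsSet hx)] with y hy
    rw [hy, one_smul]

lemma IsOrientedBoundary.trace_subset {N : ℕ} {γ : Fin N → ClosedCurve} {D : Set E2}
    (hγ : IsOrientedBoundary γ D) (hD : IsClosed D) (k : Fin N) : (γ k).trace ⊆ D :=
  (subset_iUnion (fun k => (γ k).trace) k).trans (hγ.frontier_eq ▸ hD.frontier_subset)

/-- The winding sum is prescribed everywhere except on the frontier, which is a finite union of null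
traces. -/
lemma IsOrientedBoundary.sum_winding_ae {N : ℕ} {γ : Fin N → ClosedCurve} {D : Set E2}
    (hγ : IsOrientedBoundary γ D) (hD : IsClosed D) :
    ∀ᵐ z, ∑ k, (γ k).winding z = D.indicator (fun _ => (1 : ℝ)) z := by
  have h0 : volume (frontier D) = 0 := by
    rw [hγ.frontier_eq]
    exact measure_iUnion_null fun k => (γ k).volume_trace
  filter_upwards [measure_eq_zero_iff_ae_notMem.1 h0] with z hz
  by_cases hzD : z ∈ D
  · rw [indicator_of_mem hzD]
    refine hγ.winding_interior z (by_contra fun hi => hz ⟨subset_closure hzD, hi⟩)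
  · rw [indicator_of_notMem hzD]
    exact hγ.winding_exterior z (by rwa [hD.closure_eq])

/-- Green's theorem. -/
theorem IsOrientedBoundary.green [CompleteSpace F] {N : ℕ} {γ : Fin N → ClosedCurve}
    {D U : Set E2} (hγ : IsOrientedBoundary γ D) (hD : IsCompact D) (hU : IsOpen U) (hDU : D ⊆ U)
    {P Q : E2 → F} (hP : ContDiffOn ℝ 1 P U) (hQ : ContDiffOn ℝ 1 Q U) :
    ∑ k, ∫ t in (0 : ℝ)..1, ((deriv (γ k).toFun t) 0 • P ((γ k).toFun t) +
        (deriv (γ k).toFun t) 1 • Q ((γ k).toFun t))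
      = ∫ z in D, (pderiv Q 0 z - pderiv P 1 z) := by
  obtain ⟨P', hP', hPc, hPP⟩ := exists_contDiff_compactSupport_eq_near hD hU hDU hP
  obtain ⟨Q', hQ', hQc, hQQ⟩ := exists_contDiff_compactSupport_eq_near hD hU hDU hQ
  have hline : ∀ k, ∫ t in (0 : ℝ)..1, ((deriv (γ k).toFun t) 0 • P ((γ k).toFun t) +
        (deriv (γ k).toFun t) 1 • Q ((γ k).toFun t)) =
      ∫ z, (γ k).winding z • (pderiv Q' 0 z - pderiv P' 1 z) := by
    intro k
    rw [← ((γ k).integral_oneForm hP' hQ' hPc hQc).2]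
    refine (γ k).intervalIntegral_congr_regular fun t ht => ?_
    have hm : (γ k).toFun t ∈ D :=
      hγ.trace_subset hD.isClosed k (mem_image_of_mem _ (Ioo_subset_Icc_self ht.1))
    rw [(hPP _ hm).self_of_nhds, (hQQ _ hm).self_of_nhds]
  simp_rw [hline]
  rw [← integral_finsetSum _ fun k _ => ((γ k).integral_oneForm hP' hQ' hPc hQc).1,
    ← integral_indicator hD.measurableSet]
  refine integral_congr_ae ?_
  filter_upwards [hγ.sum_winding_ae hD.isClosed] with z hz
  rw [← Finset.sum_smul, hz]
  by_cases hzD : z ∈ D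
  -- Agreement on a neighbourhood of each point of D, not just on D, is what equates the
  -- derivatives.
  · rw [indicator_of_mem hzD, indicator_of_mem hzD, one_smul, pderiv, pderiv, pderiv, pderiv,
      (hPP z hzD).fderiv_eq, (hQQ z hzD).fderiv_eq]
  · rw [indicator_of_notMem hzD, indicator_of_notMem hzD, zero_smul]

end Green

/-! ### Cross product identities -/

section Cross

lemma cross_apply_zero (a b : E3) : cross a b 0 = a 1 * b 2 - a 2 * b 1 := by
  simp [cross, cross_apply]

lemma cross_apply_one (a b : E3) : cross a b 1 = a 2 * b 0 - a 0 * b 2 := by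
  simp [cross, cross_apply]

lemma cross_apply_two (a b : E3) : cross a b 2 = a 0 * b 1 - a 1 * b 0 := by
  simp [cross, cross_apply]

lemma inner_space (a b : E3) : inner ℝ a b = a 0 * b 0 + a 1 * b 1 + a 2 * b 2 := by
  simp [PiLp.inner_apply, Fin.sum_univ_three, mul_comm]

/-- The cross product as a continuous bilinear map. -/
noncomputable def crossL : E3 →L[ℝ] E3 →L[ℝ] E3 :=
  LinearMap.toContinuousLinearMap
    ((LinearMap.toContinuousLinearMap (E := E3) (F' := E3) (𝕜 := ℝ)).toLinearMap ∘ₗ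
      LinearMap.mk₂ ℝ cross
        (fun a b c => by simp [cross]) (fun r a b => by simp [cross])
        (fun a b c => by simp [cross]) (fun r a b => by simp [cross]))

@[simp] lemma crossL_apply (a b : E3) : crossL a b = cross a b := rfl

lemma cross_smul_left (r : ℝ) (a b : E3) : cross (r • a) b = r • cross a b := by
  simp [cross]

lemma cross_swap (a b : E3) : cross a b = -cross b a := by
  ext i; fin_cases i <;> simp [cross_apply_zero, cross_apply_one, cross_apply_two] <;> ring

lemma cross_cross_left (a b c : E3) :
    cross (cross a b) c = (inner ℝ a c) • b - (inner ℝ b c) • a := by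
  ext i
  fin_cases i <;> simp [cross_apply_zero, cross_apply_one, cross_apply_two, inner_space] <;> ring

lemma inner_cross_cross (a b c d : E3) :
    inner ℝ (cross a b) (cross c d) =
      inner ℝ a c * inner ℝ b d - inner ℝ a d * inner ℝ b c := by
  simp only [inner_space, cross_apply_zero, cross_apply_one, cross_apply_two]
  ring

lemma inner_cross_left (a b : E3) : inner ℝ (cross a b) a = 0 := by
  simp only [inner_space, cross_apply_zero, cross_apply_one, cross_apply_two]
  ring

lemma inner_cross_right (a b : E3) : inner ℝ (cross a b) b = 0 := by
  simp only [inner_space, cross_apply_zero, cross_apply_one, cross_apply_two]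
  ring

/-- If a × b = 0, expanding (a × b) × a gives (a, a) b - (b, a) a = 0, and independence forces (a,
a) = 0. -/
lemma cross_ne_zero_of_linearIndependent {v : Fin 2 → E3} (h : LinearIndependent ℝ v) :
    cross (v 0) (v 1) ≠ 0 := by
  intro h0
  have h1 := cross_cross_left (v 0) (v 1) (v 0)
  rw [h0] at h1
  have h2 : cross (0 : E3) (v 0) = 0 := by simp [cross]
  rw [h2] at h1
  have h3 := (LinearIndependent.pair_iff.1 (show LinearIndependent ℝ ![v 0, v 1] by
    convert h using 1; ext i; fin_cases i <;> rfl)) (-inner ℝ (v 1) (v 0))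
    (inner ℝ (v 0) (v 0)) (by rw [neg_smul, neg_add_eq_sub, ← h1])
  exact h.ne_zero 0 (inner_self_eq_zero.1 h3.2)

end Cross

/-! ### Partial derivatives: product rules and symmetry -/

section PartialDerivatives

variable {E G H : Type*} [NormedAddCommGroup E] [NormedSpace ℝ E] [NormedAddCommGroup G]
  [NormedSpace ℝ G] [NormedAddCommGroup H] [NormedSpace ℝ H]

lemma pderiv_bilinear (B : E →L[ℝ] G →L[ℝ] H) {f : E2 → E} {g : E2 → G} {x : E2}
    (hf : DifferentiableAt ℝ f x) (hg : DifferentiableAt ℝ g x) (i : Fin 2) :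
    pderiv (fun y => B (f y) (g y)) i x = B (f x) (pderiv g i x) + B (pderiv f i x) (g x) := by
  have h := B.hasFDerivAt_of_bilinear hf.hasFDerivAt hg.hasFDerivAt
  rw [pderiv, h.fderiv]
  simp [pderiv]

lemma pderiv_inner {f g : E2 → E3} {x : E2} (hf : DifferentiableAt ℝ f x)
    (hg : DifferentiableAt ℝ g x) (i : Fin 2) :
    pderiv (fun y => inner ℝ (f y) (g y)) i x =
      inner ℝ (f x) (pderiv g i x) + inner ℝ (pderiv f i x) (g x) :=
  fderiv_inner_apply ℝ hf hg _

lemma pderiv_comm {f : E2 → E} {x : E2} (hf : ContDiffAt ℝ 2 f x) (i j : Fin 2) :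
    pderiv (pderiv f i) j x = pderiv (pderiv f j) i x := by
  have hd : DifferentiableAt ℝ (fderiv ℝ f) x :=
    (hf.fderiv_right (m := 1) le_rfl).differentiableAt one_ne_zero
  have hs : IsSymmSndFDerivAt ℝ f x := hf.isSymmSndFDerivAt (by simp)
  have key : ∀ k l : Fin 2, pderiv (pderiv f k) l x =
      fderiv ℝ (fderiv ℝ f) x (EuclideanSpace.single l 1) (EuclideanSpace.single k 1) := by
    intro k l
    have : HasFDerivAt (pderiv f k)
        ((fderiv ℝ (fderiv ℝ f) x).flip (EuclideanSpace.single k 1)) x := by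
      refine (hd.hasFDerivAt.clm_apply
        (hasFDerivAt_const (EuclideanSpace.single k (1 : ℝ)) x)).congr_fderiv ?_
      simp
    rw [pderiv, this.fderiv, ContinuousLinearMap.flip_apply]
  rw [key, key, hs.eq]

lemma ContDiffOn.pderiv {f : E2 → E} {U : Set E2} {m n : WithTop ℕ∞} (hf : ContDiffOn ℝ n f U)
    (hU : IsOpen U) (hmn : m + 1 ≤ n) (i : Fin 2) : ContDiffOn ℝ m (pderiv f i) U :=
  (hf.fderiv_of_isOpen hU hmn).clm_apply contDiffOn_const

end PartialDerivatives

/-! ### Normal, curvature and the tensor L̂ -/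

section Surface

variable {S : E2 → E3} {x : E2}

lemma det_metric (S : E2 → E3) (x : E2) :
    (metric S x).det = ‖cross (covBasis S 0 x) (covBasis S 1 x)‖ ^ 2 := by
  rw [← real_inner_self_eq_norm_sq, inner_cross_cross, Matrix.det_fin_two]
  simp [metric]

lemma sqrt_det_metric (S : E2 → E3) (x : E2) :
    √(metric S x).det = ‖cross (covBasis S 0 x) (covBasis S 1 x)‖ := by
  rw [det_metric, sqrt_sq (norm_nonneg _)]

lemma inner_unitNormal_covBasis (S : E2 → E3) (x : E2) (i : Fin 2) :
    inner ℝ (unitNormal S x) (covBasis S i x) = 0 := by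
  rw [unitNormal, inner_smul_left]
  fin_cases i
  · simp [inner_cross_left]
  · simp [inner_cross_right]

lemma inner_unitNormal_self (h : cross (covBasis S 0 x) (covBasis S 1 x) ≠ 0) :
    inner ℝ (unitNormal S x) (unitNormal S x) = 1 := by
  rw [real_inner_self_eq_norm_sq, unitNormal, norm_smul, norm_inv, norm_norm,
    inv_mul_cancel₀ (norm_ne_zero_iff.2 h), one_pow]

lemma norm_smul_unitNormal (h : cross (covBasis S 0 x) (covBasis S 1 x) ≠ 0) :
    ‖cross (covBasis S 0 x) (covBasis S 1 x)‖ • unitNormal S x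
      = cross (covBasis S 0 x) (covBasis S 1 x) := by
  rw [unitNormal, smul_smul, mul_inv_cancel₀ (norm_ne_zero_iff.2 h), one_smul]

/-- The points of `U` at which the parametrization is regular. -/
def regularPoints (S : E2 → E3) (U : Set E2) : Set E2 :=
  U ∩ {x | cross (covBasis S 0 x) (covBasis S 1 x) ≠ 0}

variable {U : Set E2}

lemma contDiffOn_cross_covBasis (hU : IsOpen U) (hS : ContDiffOn ℝ 3 S U) :
    ContDiffOn ℝ 2 (fun x => cross (covBasis S 0 x) (covBasis S 1 x)) U := by
  have h : ∀ i, ContDiffOn ℝ 2 (covBasis S i) U := fun i => hS.pderiv hU (by norm_num) i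
  exact (crossL.contDiff.comp_contDiffOn (h 0)).clm_apply (h 1)

/-- Regularity is assumed on D only; openness supplies the neighbourhood of D on which the one-form
must be C¹. -/
lemma isOpen_regularPoints (hU : IsOpen U) (hS : ContDiffOn ℝ 3 S U) :
    IsOpen (regularPoints S U) :=
  (contDiffOn_cross_covBasis hU hS).continuousOn.isOpen_inter_preimage hU isOpen_ne

lemma contDiffOn_unitNormal (hU : IsOpen U) (hS : ContDiffOn ℝ 3 S U) :
    ContDiffOn ℝ 2 (unitNormal S) (regularPoints S U) := by
  have h := (contDiffOn_cross_covBasis hU hS).mono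
    (inter_subset_left : regularPoints S U ⊆ U)
  exact ((h.norm ℝ fun x hx => hx.2).inv fun x hx => norm_ne_zero_iff.2 hx.2).smul h

variable (hU : IsOpen U) (hS : ContDiffOn ℝ 3 S U) (hx : x ∈ regularPoints S U)
include hU hS hx

lemma differentiableAt_unitNormal : DifferentiableAt ℝ (unitNormal S) x :=
  ((contDiffOn_unitNormal hU hS).contDiffAt
    ((isOpen_regularPoints hU hS).mem_nhds hx)).differentiableAt two_ne_zero

lemma differentiableAt_covBasis (i : Fin 2) : DifferentiableAt ℝ (covBasis S i) x :=
  ((hS.pderiv (m := 2) hU (by norm_num) i).contDiffAt (hU.mem_nhds hx.1)).differentiableAt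
    two_ne_zero

lemma inner_unitNormal_pderiv (i : Fin 2) :
    inner ℝ (unitNormal S x) (pderiv (unitNormal S) i x) = 0 := by
  have hd := differentiableAt_unitNormal hU hS hx
  have h := pderiv_inner hd hd i
  -- Unit length holds only where the parametrization is regular, hence near x.
  have hc : (fun y => inner ℝ (unitNormal S y) (unitNormal S y)) =ᶠ[nhds x] fun _ => (1 : ℝ) := by
    filter_upwards [(isOpen_regularPoints hU hS).mem_nhds hx] with y hy
    exact inner_unitNormal_self hy.2
  rw [pderiv, hc.fderiv_eq, fderiv_const_apply, zero_apply,
    real_inner_comm (unitNormal S x) (pderiv (unitNormal S) i x)] at h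
  linarith

/-- The Weingarten relations. -/
lemma inner_covBasis_pderiv_unitNormal (i j : Fin 2) :
    inner ℝ (covBasis S i x) (pderiv (unitNormal S) j x) = -secondForm S x i j := by
  have h := pderiv_inner (differentiableAt_covBasis hU hS hx i)
    (differentiableAt_unitNormal hU hS hx) j
  -- Orthogonality holds at every y, since `unitNormal` is 0 where the cross product vanishes.
  have hc : (fun y => inner ℝ (covBasis S i y) (unitNormal S y)) = fun _ => (0 : ℝ) := by
    funext y
    rw [real_inner_comm, inner_unitNormal_covBasis]
  rw [hc, pderiv, fderiv_const_apply, zero_apply] at h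
  simp only [secondForm, Matrix.of_apply]
  linarith

lemma secondForm_symm : secondForm S x 0 1 = secondForm S x 1 0 := by
  have h : ContDiffAt ℝ 2 S x := (hS.contDiffAt (hU.mem_nhds hx.1)).of_le (by norm_num)
  simp only [secondForm, Matrix.of_apply]
  congr 1
  exact pderiv_comm h 0 1

/-- The factor turns n into g_0 × g_1, so the triple-product identity and the Weingarten relations
apply. -/
lemma cross_unitNormal_pderiv (k : Fin 2) :
    ‖cross (covBasis S 0 x) (covBasis S 1 x)‖ • cross (unitNormal S x) (pderiv (unitNormal S) k x)
      = secondForm S x 1 k • covBasis S 0 x - secondForm S x 0 k • covBasis S 1 x := by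
  rw [← cross_smul_left, norm_smul_unitNormal hx.2, cross_cross_left,
    inner_covBasis_pderiv_unitNormal hU hS hx, inner_covBasis_pderiv_unitNormal hU hS hx]
  module

/-- Both derivatives of n are orthogonal to n, so their cross product is a multiple of n. By the
Lagrange identity J times its normal component is det[b_ij] = J² K_G. -/
lemma cross_pderiv_unitNormal :
    cross (pderiv (unitNormal S) 0 x) (pderiv (unitNormal S) 1 x)
      = (‖cross (covBasis S 0 x) (covBasis S 1 x)‖ * gaussCurvature S x) • unitNormal S x := by
  set n := unitNormal S x
  set a := pderiv (unitNormal S) 0 x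
  set b := pderiv (unitNormal S) 1 x
  set J := ‖cross (covBasis S 0 x) (covBasis S 1 x)‖ with hJ
  have hJ0 : J ≠ 0 := norm_ne_zero_iff.2 hx.2
  have hn : inner ℝ n n = 1 := inner_unitNormal_self hx.2
  have h1 : cross (cross a b) n = 0 := by
    rw [cross_cross_left, real_inner_comm, inner_unitNormal_pderiv hU hS hx, real_inner_comm,
      inner_unitNormal_pderiv hU hS hx]
    simp
  have h2 : cross a b = inner ℝ n (cross a b) • n := by
    have h := cross_cross_left (cross a b) n n
    rw [h1, hn] at h
    have h0 : cross (0 : E3) n = 0 := by simp [cross]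
    rw [h0, one_smul, real_inner_comm] at h
    exact (sub_eq_zero.1 h.symm).symm
  have h3 : J * inner ℝ n (cross a b) = (secondForm S x).det := by
    rw [← real_inner_smul_left, norm_smul_unitNormal hx.2, inner_cross_cross,
      inner_covBasis_pderiv_unitNormal hU hS hx, inner_covBasis_pderiv_unitNormal hU hS hx,
      inner_covBasis_pderiv_unitNormal hU hS hx, inner_covBasis_pderiv_unitNormal hU hS hx,
      Matrix.det_fin_two]
    ring
  rw [h2, gaussCurvature, det_metric, ← hJ, ← h3]
  congr 1
  field_simp

omit hU hS in
-- For an invertible matrix, determinant times inverse is the adjugate; then adj(g⁻¹ b) g⁻¹ = adj(b)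
-- adj(g⁻¹) g⁻¹, with adj(g⁻¹) = g / det g.
lemma hatLContra_eq (hK : (curvatureMixed S x).det ≠ 0) :
    hatLContra S x = ((metric S x).det)⁻¹ • (secondForm S x).adjugate := by
  have hg : (metric S x).det ≠ 0 := by
    rw [det_metric]
    exact pow_ne_zero _ (norm_ne_zero_iff.2 hx.2)
  have h1 : hatLMixed S x = (curvatureMixed S x).adjugate := by
    rw [hatLMixed, Matrix.inv_def, smul_smul, Ring.inverse_eq_inv', mul_inv_cancel₀ hK, one_smul]
  have h2 : (metric S x)⁻¹.adjugate = (metric S x).det⁻¹ • metric S x := by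
    have h := Matrix.nonsing_inv_nonsing_inv _ hg.isUnit
    rw [Matrix.inv_def, Matrix.det_nonsing_inv] at h
    simp only [Ring.inverse_eq_inv', inv_inv] at h
    rwa [eq_inv_smul_iff₀ hg]
  rw [hatLContra, h1, curvatureMixed, Matrix.adjugate_mul_distrib, h2, Matrix.mul_smul,
    Matrix.smul_mul, Matrix.mul_assoc, Matrix.mul_nonsing_inv _ hg.isUnit, Matrix.mul_one]

/-- The rows of the contravariant components of `L̂`, written through derivatives of the normal. -/
lemma sqrt_smul_sum_hatLContra (hK : (curvatureMixed S x).det ≠ 0) :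
    (√(metric S x).det • ∑ k, hatLContra S x 0 k • covBasis S k x
        = cross (unitNormal S x) (pderiv (unitNormal S) 1 x)) ∧
    √(metric S x).det • ∑ k, hatLContra S x 1 k • covBasis S k x
        = -cross (unitNormal S x) (pderiv (unitNormal S) 0 x) := by
  have hJ0 : ‖cross (covBasis S 0 x) (covBasis S 1 x)‖ ≠ 0 := norm_ne_zero_iff.2 hx.2
  have h0 := cross_unitNormal_pderiv hU hS hx 0
  have h1 := cross_unitNormal_pderiv hU hS hx 1
  have hs := secondForm_symm hU hS hx
  rw [hatLContra_eq hx hK, det_metric, sqrt_sq (norm_nonneg _), Matrix.adjugate_fin_two]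
  constructor <;> refine smul_right_injective E3 hJ0 ?_ <;> simp only [Fin.sum_univ_two]
  · rw [h1]
    simp
    match_scalars <;> field_simp
  · rw [smul_neg, h0]
    simp
    match_scalars <;> field_simp

lemma hatLContra_symm (hK : (curvatureMixed S x).det ≠ 0) (i j : Fin 2) :
    hatLContra S x i j = hatLContra S x j i := by
  have hs := secondForm_symm hU hS hx
  rw [hatLContra_eq hx hK, Matrix.adjugate_fin_two]
  fin_cases i <;> fin_cases j <;> simp [hs]

omit hU hS hx in
lemma dotHatL_eq (S : E2 → E3) (x : E2) (a : E3) :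
    dotHatL S x a = inner ℝ a (covBasis S 0 x) • ∑ k, hatLContra S x 0 k • covBasis S k x +
      inner ℝ a (covBasis S 1 x) • ∑ k, hatLContra S x 1 k • covBasis S k x := by
  simp only [dotHatL, contraBasis, hatLContra, Matrix.mul_apply, Fin.sum_univ_two]
  module

/-- The conormal contracted with `L̂` along a tangent vector. -/
lemma dotHatL_cross_unitNormal (hK : (curvatureMixed S x).det ≠ 0) (v : E2) :
    dotHatL S x (cross (v 0 • covBasis S 0 x + v 1 • covBasis S 1 x) (unitNormal S x)) =
      v 0 • cross (unitNormal S x) (pderiv (unitNormal S) 0 x) +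
      v 1 • cross (unitNormal S x) (pderiv (unitNormal S) 1 x) := by
  obtain ⟨h0, h1⟩ := sqrt_smul_sum_hatLContra hU hS hx hK
  set J := ‖cross (covBasis S 0 x) (covBasis S 1 x)‖ with hJ
  have hn : J • unitNormal S x = cross (covBasis S 0 x) (covBasis S 1 x) :=
    norm_smul_unitNormal hx.2
  have hJ0 : J ≠ 0 := norm_ne_zero_iff.2 hx.2
  have hnn : inner ℝ (unitNormal S x) (cross (covBasis S 0 x) (covBasis S 1 x)) = J := by
    rw [← hn, inner_smul_right, inner_unitNormal_self hx.2, mul_one]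
  -- Only the component of the tangent along the other basis vector survives in the triple product,
  -- giving ±J.
  have e0 : inner ℝ (cross (v 0 • covBasis S 0 x + v 1 • covBasis S 1 x) (unitNormal S x))
      (covBasis S 0 x) = v 1 * J := by
    rw [← hnn]
    simp only [inner_space, cross_apply_zero, cross_apply_one, cross_apply_two, PiLp.add_apply,
      PiLp.smul_apply, smul_eq_mul]
    ring
  have e1 : inner ℝ (cross (v 0 • covBasis S 0 x + v 1 • covBasis S 1 x) (unitNormal S x))
      (covBasis S 1 x) = -(v 0 * J) := by
    rw [← hnn]
    simp only [inner_space, cross_apply_zero, cross_apply_one, cross_apply_two, PiLp.add_apply,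
      PiLp.smul_apply, smul_eq_mul]
    ring
  rw [sqrt_det_metric, ← hJ] at h0 h1
  rw [dotHatL_eq, e0, e1, neg_smul, mul_smul, mul_smul, h0, h1]
  module

end Surface

lemma contDiffOn_bilinear {E G H : Type*} [NormedAddCommGroup E] [NormedSpace ℝ E]
    [NormedAddCommGroup G] [NormedSpace ℝ G] [NormedAddCommGroup H] [NormedSpace ℝ H]
    {n : WithTop ℕ∞} (B : E →L[ℝ] G →L[ℝ] H) {f : E2 → E} {g : E2 → G} {U : Set E2}
    (hf : ContDiffOn ℝ n f U) (hg : ContDiffOn ℝ n g U) :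
    ContDiffOn ℝ n (fun x => B (f x) (g x)) U :=
  (B.contDiff.comp_contDiffOn hf).clm_apply hg

/-! ### The one-form (n × dn) ∘ Φ and its curl -/

section SurfaceGreen

variable {p q : ℕ} {S : E2 → E3} {x : E2} {U : Set E2}

/-- The `i`-th coefficient of the one-form `(n × dn) ∘ Φ`. -/
noncomputable def normalForm (S : E2 → E3) (op : E3 →L[ℝ] Tensor p →L[ℝ] Tensor q)
    (Φ : E2 → Tensor p) (i : Fin 2) (x : E2) : Tensor q :=
  op (cross (unitNormal S x) (pderiv (unitNormal S) i x)) (Φ x)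

variable (hU : IsOpen U) (hS : ContDiffOn ℝ 3 S U) (op : E3 →L[ℝ] Tensor p →L[ℝ] Tensor q)
  {Φ : E2 → Tensor p} (hΦ : ContDiffOn ℝ 1 Φ U)
include hU hS

lemma contDiffOn_pderiv_unitNormal (i : Fin 2) :
    ContDiffOn ℝ 1 (pderiv (unitNormal S) i) (regularPoints S U) :=
  (contDiffOn_unitNormal hU hS).pderiv (isOpen_regularPoints hU hS) (by norm_num) i

lemma contDiffOn_cross_unitNormal_pderiv (i : Fin 2) :
    ContDiffOn ℝ 1 (fun x => cross (unitNormal S x) (pderiv (unitNormal S) i x))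
      (regularPoints S U) :=
  (crossL.contDiff.comp_contDiffOn ((contDiffOn_unitNormal hU hS).of_le (by norm_num))).clm_apply
    (contDiffOn_pderiv_unitNormal hU hS i)

include hΦ in
lemma contDiffOn_normalForm (i : Fin 2) :
    ContDiffOn ℝ 1 (normalForm S op Φ i) (regularPoints S U) :=
  contDiffOn_bilinear op (contDiffOn_cross_unitNormal_pderiv hU hS i) (hΦ.mono inter_subset_left)

include hΦ in
lemma pderiv_normalForm (hx : x ∈ regularPoints S U) (i j : Fin 2) :
    pderiv (normalForm S op Φ i) j x =
      op (cross (unitNormal S x) (pderiv (unitNormal S) i x)) (pderiv Φ j x) +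
      op (cross (unitNormal S x) (pderiv (pderiv (unitNormal S) i) j x) +
        cross (pderiv (unitNormal S) j x) (pderiv (unitNormal S) i x)) (Φ x) := by
  have hmem := (isOpen_regularPoints hU hS).mem_nhds hx
  have h1 := ((contDiffOn_cross_unitNormal_pderiv hU hS i).contDiffAt hmem).differentiableAt
    one_ne_zero
  have h2 := (hΦ.contDiffAt (hU.mem_nhds hx.1)).differentiableAt one_ne_zero
  have h3 := ((contDiffOn_pderiv_unitNormal hU hS i).contDiffAt hmem).differentiableAt one_ne_zero
  have h4 := pderiv_bilinear crossL (differentiableAt_unitNormal hU hS hx) h3 j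
  simp only [crossL_apply] at h4
  rw [← h4]
  exact pderiv_bilinear op h1 h2 j

include hΦ in
-- The mixed second derivatives of n commute (n is C² because the surface is C³) and cancel; the two
-- products of first derivatives add up by antisymmetry, which is the source of the factor 2.
lemma curl_normalForm (hx : x ∈ regularPoints S U) :
    pderiv (normalForm S op Φ 1) 0 x - pderiv (normalForm S op Φ 0) 1 x =
      (op (cross (unitNormal S x) (pderiv (unitNormal S) 1 x)) (pderiv Φ 0 x) -
        op (cross (unitNormal S x) (pderiv (unitNormal S) 0 x)) (pderiv Φ 1 x)) +
      op ((2 : ℝ) • cross (pderiv (unitNormal S) 0 x) (pderiv (unitNormal S) 1 x)) (Φ x) := by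
  have hc : pderiv (pderiv (unitNormal S) 1) 0 x = pderiv (pderiv (unitNormal S) 0) 1 x :=
    pderiv_comm ((contDiffOn_unitNormal hU hS).contDiffAt
      ((isOpen_regularPoints hU hS).mem_nhds hx)) 1 0
  rw [pderiv_normalForm hU hS op hΦ hx, pderiv_normalForm hU hS op hΦ hx, hc,
    cross_swap (pderiv (unitNormal S) 1 x)]
  simp only [map_add, map_neg, map_smul, add_apply, neg_apply, smul_apply]
  module

/-- The operator contracts the first index of L̂^{ij} with the basis, the row formulas the second;
symmetry of L̂ reconciles them. -/
lemma sqrt_smul_barNabla (hx : x ∈ regularPoints S U) (hK : (curvatureMixed S x).det ≠ 0) :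
    √(metric S x).det • barNabla S op Φ x =
      op (cross (unitNormal S x) (pderiv (unitNormal S) 1 x)) (pderiv Φ 0 x) -
        op (cross (unitNormal S x) (pderiv (unitNormal S) 0 x)) (pderiv Φ 1 x) := by
  obtain ⟨h0, h1⟩ := sqrt_smul_sum_hatLContra hU hS hx hK
  rw [← neg_eq_iff_eq_neg] at h1
  rw [← h0, ← h1]
  simp only [barNabla, Fin.sum_univ_two, hatLContra_symm hU hS hx hK 1 0, map_add, map_neg,
    map_smul, add_apply, neg_apply, smul_apply]
  module

lemma sqrt_smul_gaussCurvature (hx : x ∈ regularPoints S U) :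
    √(metric S x).det • ((2 * gaussCurvature S x) • op (unitNormal S x) (Φ x)) =
      op ((2 : ℝ) • cross (pderiv (unitNormal S) 0 x) (pderiv (unitNormal S) 1 x)) (Φ x) := by
  rw [cross_pderiv_unitNormal hU hS hx, sqrt_det_metric]
  simp only [map_smul, smul_apply]
  module

omit hU hS in
lemma dotHatL_smul (S : E2 → E3) (x : E2) (r : ℝ) (a : E3) :
    dotHatL S x (r • a) = r • dotHatL S x a := by
  simp only [dotHatL_eq, inner_smul_left]
  simp only [conj_trivial]
  module

/-- The integrand of the line integral along the image of a plane curve. -/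
lemma norm_smul_conormal (hx : x ∈ regularPoints S U) (hK : (curvatureMixed S x).det ≠ 0)
    (v : E2) :
    ‖fderiv ℝ S x v‖ • op (dotHatL S x (cross (‖fderiv ℝ S x v‖⁻¹ • fderiv ℝ S x v)
        (unitNormal S x))) (Φ x) =
      v 0 • normalForm S op Φ 0 x + v 1 • normalForm S op Φ 1 x := by
  have h1 : op (dotHatL S x (cross (fderiv ℝ S x v) (unitNormal S x))) (Φ x) =
      v 0 • normalForm S op Φ 0 x + v 1 • normalForm S op Φ 1 x := by
    have h := dotHatL_cross_unitNormal hU hS hx hK v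
    rw [fderiv_eq_pderiv]
    simp only [covBasis] at h
    rw [h]
    simp only [normalForm, map_add, map_smul, add_apply, smul_apply]
  rw [← h1]
  -- Where the image curve has zero velocity its unit tangent is 0 by convention, and both sides
  -- vanish.
  by_cases hd : fderiv ℝ S x v = 0
  · have h0 : dotHatL S x (cross 0 (unitNormal S x)) = 0 := by
      have hz : cross 0 (unitNormal S x) = 0 := by simp [cross]
      rw [hz]
      simpa using dotHatL_smul S x 0 (cross (0 : E3) (unitNormal S x))
    simp [hd, h0]
  · rw [cross_smul_left, dotHatL_smul, map_smul, smul_apply, smul_smul,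
      mul_inv_cancel₀ (norm_ne_zero_iff.2 hd), one_smul]

end SurfaceGreen

/-! ### The integral formula on the surface -/

theorem proposition4 {p q N : ℕ}
    -- the plane domain with its positively oriented boundary
    (D U : Set E2) (hD : IsCompact D) (hU : IsOpen U) (hDU : D ⊆ U)
    (γ : Fin N → ClosedCurve) (hγ : IsOrientedBoundary γ D)
    -- the regular parametrized surface, with nonsingular curvature tensor
    (S : E2 → E3) (hS : ContDiffOn ℝ 3 S U)
    (hreg : ∀ x ∈ D, LinearIndependent ℝ (fun i : Fin 2 => covBasis S i x))
    (hK : ∀ x ∈ D, (curvatureMixed S x).det ≠ 0)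
    -- the tensor field and the bilinear operation of vectors with tensors
    (Φ : E2 → Tensor p) (hΦ : ContDiffOn ℝ 1 Φ U)
    (op : E3 →L[ℝ] Tensor p →L[ℝ] Tensor q) :
    ∑ k, lineIntegral S (γ k)
        (fun x τ => op (dotHatL S x (cross τ (unitNormal S x))) (Φ x))
      = surfaceIntegral S D (fun x => barNabla S op Φ x)
        + surfaceIntegral S D
            (fun x => (2 * gaussCurvature S x) • op (unitNormal S x) (Φ x)) := by
  have hDR : D ⊆ regularPoints S U := fun x hx =>
    ⟨hDU hx, cross_ne_zero_of_linearIndependent (hreg x hx)⟩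
  have hline : ∀ k, lineIntegral S (γ k)
        (fun x τ => op (dotHatL S x (cross τ (unitNormal S x))) (Φ x)) =
      ∫ t in (0 : ℝ)..1, ((deriv (γ k).toFun t) 0 • normalForm S op Φ 0 ((γ k).toFun t) +
        (deriv (γ k).toFun t) 1 • normalForm S op Φ 1 ((γ k).toFun t)) := by
    intro k
    refine (γ k).intervalIntegral_congr_regular fun t ht => ?_
    have hm : (γ k).toFun t ∈ D :=
      hγ.trace_subset hD.isClosed k (mem_image_of_mem _ (Ioo_subset_Icc_self ht.1))
    have hSd : DifferentiableAt ℝ S ((γ k).toFun t) :=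
      (hS.contDiffAt (hU.mem_nhds (hDU hm))).differentiableAt (by norm_num)
    have hd : deriv (S ∘ (γ k).toFun) t = fderiv ℝ S ((γ k).toFun t) (deriv (γ k).toFun t) :=
      (hSd.hasFDerivAt.comp_hasDerivAt t ((γ k).differentiableAt ht).hasDerivAt).deriv
    simp only [hd]
    exact norm_smul_conormal hU hS op (hDR hm) (hK _ hm) _
  simp_rw [hline]
  rw [hγ.green hD (isOpen_regularPoints hU hS) hDR (contDiffOn_normalForm hU hS op hΦ 0)
    (contDiffOn_normalForm hU hS op hΦ 1)]
  -- Continuity on the compact set D gives the integrability needed to add the two surface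
  -- integrals.
  have hcn : ∀ i, ContinuousOn (pderiv (unitNormal S) i) D := fun i =>
    (contDiffOn_pderiv_unitNormal hU hS i).continuousOn.mono hDR
  have hop : ∀ f : E2 → E3, ContinuousOn f D → ContinuousOn (fun x => op (f x)) D := fun f hf =>
    op.continuous.comp_continuousOn hf
  have hcv : ∀ i, ContinuousOn
      (fun x => cross (unitNormal S x) (pderiv (unitNormal S) i x)) D := fun i =>
    (contDiffOn_cross_unitNormal_pderiv hU hS i).continuousOn.mono hDR
  have hcΦ : ∀ i, ContinuousOn (pderiv Φ i) D := fun i =>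
    ((hΦ.pderiv (m := 0) hU (by norm_num) i).continuousOn).mono hDU
  have hi1 : IntegrableOn (fun x =>
      op (cross (unitNormal S x) (pderiv (unitNormal S) 1 x)) (pderiv Φ 0 x) -
        op (cross (unitNormal S x) (pderiv (unitNormal S) 0 x)) (pderiv Φ 1 x)) D :=
    (((hop _ (hcv 1)).clm_apply (hcΦ 0)).sub
      ((hop _ (hcv 0)).clm_apply (hcΦ 1))).integrableOn_compact hD
  have hcc : ContinuousOn (fun x =>
      cross (pderiv (unitNormal S) 0 x) (pderiv (unitNormal S) 1 x)) D :=
    (crossL.continuous.comp_continuousOn (hcn 0)).clm_apply (hcn 1)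
  have hi2 : IntegrableOn (fun x =>
      op ((2 : ℝ) • cross (pderiv (unitNormal S) 0 x) (pderiv (unitNormal S) 1 x)) (Φ x)) D :=
    ((hop _ (hcc.const_smul (2 : ℝ))).clm_apply
      (hΦ.continuousOn.mono hDU)).integrableOn_compact hD
  rw [surfaceIntegral, surfaceIntegral,
    setIntegral_congr_fun hD.measurableSet fun x hx =>
      sqrt_smul_barNabla hU hS op (hDR hx) (hK x hx),
    setIntegral_congr_fun hD.measurableSet fun x hx => sqrt_smul_gaussCurvature hU hS op (hDR hx),
    ← integral_add hi1 hi2]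
  exact setIntegral_congr_fun hD.measurableSet fun x hx => curl_normalForm hU hS op hΦ (hDR hx)
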